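/- An $n\times n$ grid is a Cartesian product $X\times Y\subset\mathbb{R}^2$ of two sets $X,Y$ of $n$ real numbers each; its $2n$ grid lines are the vertical lines $x=a$ with $a\in X$ and the horizontal lines $y=b$ with $b\in Y$. A polygon is convex if all of its internal angles are strictly smaller than $\pi$. A grid contains a convex polygon if every vertex of the polygon is a point of the grid, and a grid line is used by the polygon as many times as it contains vertices of the polygon. Taking maxima over all $n\times n$ grids, let $F(n)$ be the maximum number of convex polygons contained in an $n\times n$ grid; let $\bar F(n)$ be the maximum number of convex polygons contained in an $n\times n$ grid that use each grid line at most once (supported polygons); let $G(n)$ be the maximum number of convex polygons contained in an $n\times n$ grid that use each of the $2n$ grid lines at least once; and let $\bar G(n)$ be the maximum number of convex polygons contained in an $n\times n$ grid that use each of the $2n$ grid lines exactly once. Then \[ F(n)=\Theta^*(16^n),\qquad \bar F(n)=\Theta^*(9^n),\qquad G(n)=\Theta^*(9^n),\qquad \bar G(n)=\Theta^*(4^n), \] where $f(n)=\Theta^*(g(n))$ means that there are constants $c,C>0$ and $k\in\mathbb{N}$ such that $c\,n^{-k}g(n)\le f(n)\le C\,n^{k}g(n)$ for all sufficiently large $n$.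 -/

import Mathlib

open Filter Asymptotics

namespace ConvexGrid

/-- A convex polygon in the plane, as a closed region: the convex hull of finitely many points,
with nonempty interior. -/
def IsConvexPolygon (P : Set (ℝ × ℝ)) : Prop :=
  (∃ S : Finset (ℝ × ℝ), P = convexHull ℝ (S : Set (ℝ × ℝ))) ∧ (interior P).Nonempty

/-- The vertices of a convex polygon are its extreme points, i.e. the corners, at which the
internal angle is strictly smaller than `π`. -/
def vertices (P : Set (ℝ × ℝ)) : Set (ℝ × ℝ) :=
  P.extremePoints ℝ

/-- The grid `X × Y` contains `P`: every vertex of `P` is a grid point. -/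
def GridContains (X Y : Finset ℝ) (P : Set (ℝ × ℝ)) : Prop :=
  ∀ v ∈ vertices P, v.1 ∈ X ∧ v.2 ∈ Y

/-- No two distinct vertices of `P` share an `x`- or a `y`-coordinate: every axis-parallel line
is used at most once. -/
def LinesAtMostOnce (P : Set (ℝ × ℝ)) : Prop :=
  ∀ u ∈ vertices P, ∀ v ∈ vertices P, (u.1 = v.1 ∨ u.2 = v.2) → u = v

/-- Every vertical line `x = a` with `a ∈ X` and every horizontal line `y = b` with `b ∈ Y`
contains at least one vertex of `P`. -/
def AllLinesUsed (X Y : Finset ℝ) (P : Set (ℝ × ℝ)) : Prop :=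
  (∀ a ∈ X, ∃ v ∈ vertices P, v.1 = a) ∧ (∀ b ∈ Y, ∃ v ∈ vertices P, v.2 = b)

/-- All convex polygons contained in the grid `X × Y`. -/
def containedPolygons (X Y : Finset ℝ) : Set (Set (ℝ × ℝ)) :=
  {P | IsConvexPolygon P ∧ GridContains X Y P}

/-- The convex polygons supported by the grid `X × Y`. -/
def supportedPolygons (X Y : Finset ℝ) : Set (Set (ℝ × ℝ)) :=
  {P | IsConvexPolygon P ∧ GridContains X Y P ∧ LinesAtMostOnce P}

/-- The convex polygons contained in `X × Y` that use every grid line at least once. -/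
def allLinesPolygons (X Y : Finset ℝ) : Set (Set (ℝ × ℝ)) :=
  {P | IsConvexPolygon P ∧ GridContains X Y P ∧ AllLinesUsed X Y P}

/-- The convex polygons contained in `X × Y` that use every grid line exactly once. -/
def exactlyOncePolygons (X Y : Finset ℝ) : Set (Set (ℝ × ℝ)) :=
  {P | IsConvexPolygon P ∧ GridContains X Y P ∧ AllLinesUsed X Y P ∧ LinesAtMostOnce P}

/-- The values taken by the number of polygons of a given kind, over all `n × n` grids. -/
def gridCounts (kind : Finset ℝ → Finset ℝ → Set (Set (ℝ × ℝ))) (n : ℕ) : Set ℕ :=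
  {k | ∃ X Y : Finset ℝ, X.card = n ∧ Y.card = n ∧ k = (kind X Y).ncard}

/-- The maximum number of polygons of a given kind in an `n × n` grid. For kinds that consist of
contained polygons the maximum is attained, see `isGreatest_maxCount`. -/
noncomputable def maxCount (kind : Finset ℝ → Finset ℝ → Set (Set (ℝ × ℝ))) (n : ℕ) : ℕ :=
  sSup (gridCounts kind n)

/-- `F n`: contained convex polygons. -/
noncomputable def F (n : ℕ) : ℕ := maxCount containedPolygons n

/-- `Fbar n`: supported convex polygons (each grid line used at most once). -/
noncomputable def Fbar (n : ℕ) : ℕ := maxCount supportedPolygons n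

/-- `G n`: contained convex polygons using all `2n` grid lines. -/
noncomputable def G (n : ℕ) : ℕ := maxCount allLinesPolygons n

/-- `Gbar n`: contained convex polygons using all `2n` grid lines exactly once. -/
noncomputable def Gbar (n : ℕ) : ℕ := maxCount exactlyOncePolygons n

/-- `f = O*(g)`: big-O up to a polynomial factor in `n`. -/
def IsBigOStar (f g : ℕ → ℝ) : Prop :=
  ∃ k : ℕ, f =O[atTop] fun n : ℕ => (n : ℝ) ^ k * g n

/-- `f = Θ*(g)`: `f = O*(g)` and `g = O*(f)`, the latter being `f = Ω*(g)`. -/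
def IsThetaStar (f g : ℕ → ℝ) : Prop :=
  IsBigOStar f g ∧ IsBigOStar g f

/-- A convex polygon is the convex hull of its vertices. -/
theorem IsConvexPolygon.eq_convexHull {P : Set (ℝ × ℝ)} (hP : IsConvexPolygon P) :
    P = convexHull ℝ (vertices P) := by
  obtain ⟨⟨S, rfl⟩, -⟩ := hP
  have hfin : (vertices (convexHull ℝ (S : Set (ℝ × ℝ)))).Finite :=
    S.finite_toSet.subset extremePoints_convexHull_subset
  have h := closure_convexHull_extremePoints (S.finite_toSet.isCompact_convexHull (𝕜 := ℝ))
    (convex_convexHull ℝ (S : Set (ℝ × ℝ)))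
  rw [← (hfin.isCompact_convexHull (𝕜 := ℝ)).isClosed.closure_eq]
  exact h.symm

/-- Mapping a contained polygon to its vertex set is injective with values in the subsets of the
grid, so that there are only finitely many contained polygons. -/
theorem containedPolygons_finite_and_ncard_le (X Y : Finset ℝ) :
    (containedPolygons X Y).Finite ∧
      (containedPolygons X Y).ncard ≤ 2 ^ (X.card * Y.card) := by
  have hsub : containedPolygons X Y ⊆
      (fun V : Finset (ℝ × ℝ) => convexHull ℝ (V : Set (ℝ × ℝ))) ''
        ((X ×ˢ Y).powerset : Set (Finset (ℝ × ℝ))) := by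
    rintro P ⟨hP, hg⟩
    have hs : vertices P ⊆ ((X ×ˢ Y : Finset (ℝ × ℝ)) : Set (ℝ × ℝ)) := fun v hv => by
      simpa using hg v hv
    have hfin : (vertices P).Finite := (X ×ˢ Y).finite_toSet.subset hs
    refine ⟨hfin.toFinset, ?_, ?_⟩
    · simpa [Finset.mem_powerset, ← Finset.coe_subset] using hs
    · simpa using hP.eq_convexHull.symm
  have hf := ((X ×ˢ Y).powerset.finite_toSet).image
    (fun V : Finset (ℝ × ℝ) => convexHull ℝ (V : Set (ℝ × ℝ)))
  refine ⟨hf.subset hsub, (Set.ncard_le_ncard hsub hf).trans ?_⟩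
  refine (Set.ncard_image_le (Finset.finite_toSet _)).trans ?_
  rw [Set.ncard_coe_finset, Finset.card_powerset, Finset.card_product]

/-- The maximum in `maxCount` is attained for every kind of contained polygons. -/
theorem isGreatest_maxCount {kind : Finset ℝ → Finset ℝ → Set (Set (ℝ × ℝ))}
    (hk : ∀ X Y, kind X Y ⊆ containedPolygons X Y) (n : ℕ) :
    IsGreatest (gridCounts kind n) (maxCount kind n) := by
  have hb : BddAbove (gridCounts kind n) := by
    refine ⟨2 ^ (n * n), ?_⟩
    rintro k ⟨X, Y, hX, hY, rfl⟩
    obtain ⟨h1, h2⟩ := containedPolygons_finite_and_ncard_le X Y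
    rw [hX, hY] at h2
    exact (Set.ncard_le_ncard (hk X Y) h1).trans h2
  have hne : (gridCounts kind n).Nonempty := by
    obtain ⟨X, hX⟩ := Infinite.exists_subset_card_eq ℝ n
    exact ⟨_, X, X, hX, hX, rfl⟩
  exact ⟨Nat.sSup_mem hne hb, fun k hk' => le_csSup hb hk'⟩

end ConvexGrid

/-! All four counts are governed by one number: in how many ways a single grid line may belong to
two sets, one for each of two opposite sides of the polygon. There are 4 patterns in general, 3 if
the line must be used, 3 if it may not lie in both sets, and 2 under both constraints. With ℓ
patterns, the n vertical and n horizontal lines give (ℓ²)^n up to a polynomial factor.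

Upper bound. Each vertex maximizes a linear functional with nonzero coefficients, whose signs label
it by a quadrant. Vertices with one label form a strictly monotone chain, so they are determined by
their sets of abscissae and of ordinates (`IsChainOfSign.subset`). For a fixed vertical sign, the
left chain lies strictly to the left of the right one, so the union of their abscissae and the size
of the left part recover both; ordinates behave likewise. The polygon is thus encoded by a pair of
subsets of X, a pair of subsets of Y and four sizes (`ncard_polygonsOfKind_le`).

Lower bound. In a grid whose columns approach ±1 geometrically fast and whose rows are equally
spaced, equally large sets of columns and rows in each quadrant can be matched in reverse order, and
the matched points are always in convex position (`quadrantMatching_strict_functional`). Each of the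
four half-axes receives a pair of line sets with the same prescribed sizes, so that the numbers
agree in every quadrant. By pigeonhole some sizes retain a polynomial fraction of all pairs
(`exists_le_card_sizedPairs`). -/

namespace ConvexGrid

/-! ### Pairs of subsets and membership patterns -/

/-- Contained convex polygons, using every line at least once if `cover`, and at most once if
`disj`. -/
def polygonsOfKind (cover disj : Bool) (X Y : Finset ℝ) : Set (Set (ℝ × ℝ)) :=
  {P | IsConvexPolygon P ∧ GridContains X Y P ∧ (cover → AllLinesUsed X Y P) ∧
    (disj → LinesAtMostOnce P)}

/-- Pairs of subsets of `s`, covering `s` if `cover`, and disjoint if `disj`. -/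
def labelPairs {α : Type*} [DecidableEq α] (cover disj : Bool) (s : Finset α) :
    Finset (Finset α × Finset α) :=
  (s.powerset ×ˢ s.powerset).filter
    fun p => (cover → p.1 ∪ p.2 = s) ∧ (disj → Disjoint p.1 p.2)

/-- The admissible membership patterns of an element in a pair of `labelPairs`. -/
def labels (cover disj : Bool) : Finset (Bool × Bool) :=
  Finset.univ.filter fun l => (cover → l.1 ∨ l.2) ∧ (disj → ¬ (l.1 ∧ l.2))

theorem mem_labelPairs {α : Type*} [DecidableEq α] {cover disj : Bool} {s : Finset α}
    {p : Finset α × Finset α} :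
    p ∈ labelPairs cover disj s ↔ (p.1 ⊆ s ∧ p.2 ⊆ s) ∧
      (cover → p.1 ∪ p.2 = s) ∧ (disj → Disjoint p.1 p.2) := by
  simp [labelPairs]

/-- A pair of subsets amounts to an independent choice of a membership pattern for each element,
since both constraints can be checked elementwise. -/
theorem card_labelPairs {α : Type*} [DecidableEq α] (cover disj : Bool) (s : Finset α) :
    (labelPairs cover disj s).card = (labels cover disj).card ^ s.card := by
  have h : (Fintype.piFinset fun _ : s => labels cover disj).card
      = (labels cover disj).card ^ s.card := by
    simp [Fintype.card_piFinset]
  rw [← h]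
  refine Finset.card_bij (fun p _ i => (decide (i.1 ∈ p.1), decide (i.1 ∈ p.2))) ?_ ?_ ?_
  · intro p hp
    obtain ⟨-, h1, h2⟩ := mem_labelPairs.1 hp
    simp only [Fintype.mem_piFinset, labels, Finset.mem_filter, Finset.mem_univ, true_and,
      decide_eq_true_eq]
    intro i
    refine ⟨fun hc => ?_, fun hd hi => ?_⟩
    · exact Finset.mem_union.1 ((h1 hc).symm ▸ i.2 : i.1 ∈ p.1 ∪ p.2)
    · exact Finset.disjoint_left.1 (h2 hd) hi.1 hi.2
  · intro p hp q hq hpq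
    obtain ⟨⟨hp1, hp2⟩, -⟩ := mem_labelPairs.1 hp
    obtain ⟨⟨hq1, hq2⟩, -⟩ := mem_labelPairs.1 hq
    have key : ∀ i ∈ s, (i ∈ p.1 ↔ i ∈ q.1) ∧ (i ∈ p.2 ↔ i ∈ q.2) := fun i hi => by
      have := congrFun hpq ⟨i, hi⟩
      simpa using this
    ext i
    · exact ⟨fun h => (key i (hp1 h)).1.1 h, fun h => (key i (hq1 h)).1.2 h⟩
    · exact ⟨fun h => (key i (hp2 h)).2.1 h, fun h => (key i (hq2 h)).2.2 h⟩
  · intro f hf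
    have hf' : ∀ i, (cover = true → (f i).1 = true ∨ (f i).2 = true) ∧
        (disj = true → ¬ ((f i).1 = true ∧ (f i).2 = true)) := by
      simpa [Fintype.mem_piFinset, labels] using hf
    refine ⟨((s.attach.filter fun i => (f i).1 = true).image (fun i => i.1),
      (s.attach.filter fun i => (f i).2 = true).image (fun i => i.1)), ?_, ?_⟩
    · refine mem_labelPairs.2 ⟨⟨?_, ?_⟩, fun hc => ?_, fun hd => ?_⟩
      · intro i hi
        simp only [Finset.mem_image] at hi
        obtain ⟨a, -, rfl⟩ := hi
        exact a.2
      · intro i hi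
        simp only [Finset.mem_image] at hi
        obtain ⟨a, -, rfl⟩ := hi
        exact a.2
      · ext i
        simp only [Finset.mem_union, Finset.mem_image, Finset.mem_filter, Finset.mem_attach,
          true_and]
        constructor
        · rintro (⟨a, -, rfl⟩ | ⟨a, -, rfl⟩) <;> exact a.2
        · intro hi
          rcases (hf' ⟨i, hi⟩).1 hc with h | h
          · exact Or.inl ⟨⟨i, hi⟩, h, rfl⟩
          · exact Or.inr ⟨⟨i, hi⟩, h, rfl⟩
      · rw [Finset.disjoint_left]
        intro i hi hi'
        simp only [Finset.mem_image, Finset.mem_filter, Finset.mem_attach, true_and] at hi hi'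
        obtain ⟨a, ha, rfl⟩ := hi
        obtain ⟨b, hb, hab⟩ := hi'
        obtain rfl : b = a := Subtype.ext hab
        exact (hf' b).2 hd ⟨ha, hb⟩
    · funext i
      ext <;> simp

/-! ### Quadrants of supporting directions -/

/-- The sign encoded by a Boolean. -/
noncomputable def sgn (b : Bool) : ℝ := if b then 1 else -1

/-- The point `p` maximizes over `V` a linear functional whose coefficients are nonzero and have
the signs given by `c`. -/
def InQuadrant (V : Finset (ℝ × ℝ)) (c : Bool × Bool) (p : ℝ × ℝ) : Prop :=
  ∃ a > 0, ∃ b > 0, ∀ q ∈ V,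
    sgn c.1 * (a * q.1) + sgn c.2 * (b * q.2) ≤ sgn c.1 * (a * p.1) + sgn c.2 * (b * p.2)

theorem exists_strict_functional {V : Finset (ℝ × ℝ)} {p : ℝ × ℝ}
    (hp : p ∉ convexHull ℝ ((V : Set (ℝ × ℝ)) \ {p})) :
    ∃ a b : ℝ, ∀ q ∈ V, q ≠ p → a * q.1 + b * q.2 < a * p.1 + b * p.2 := by
  have hfin : ((V : Set (ℝ × ℝ)) \ {p}).Finite := V.finite_toSet.sdiff
  obtain ⟨f, u, h1, h2⟩ := geometric_hahn_banach_closed_point (convex_convexHull ℝ _)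
    (hfin.isCompact_convexHull (𝕜 := ℝ)).isClosed hp
  have hf : ∀ q : ℝ × ℝ, f q = f (1, 0) * q.1 + f (0, 1) * q.2 := by
    intro q
    have : q = q.1 • ((1, 0) : ℝ × ℝ) + q.2 • ((0, 1) : ℝ × ℝ) := by ext <;> simp
    conv_lhs => rw [this]
    rw [map_add, map_smul, map_smul, smul_eq_mul, smul_eq_mul]
    ring
  refine ⟨f (1, 0), f (0, 1), fun q hq hqp => ?_⟩
  rw [← hf, ← hf]
  exact (h1 q (subset_convexHull ℝ _ ⟨hq, hqp⟩)).trans h2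

theorem exists_inQuadrant {V : Finset (ℝ × ℝ)} {p : ℝ × ℝ}
    (hp : p ∉ convexHull ℝ ((V : Set (ℝ × ℝ)) \ {p})) : ∃ c, InQuadrant V c p := by
  obtain ⟨a, b, hab⟩ := exists_strict_functional hp
  -- Adding the same small t ≠ 0 to both coefficients makes them nonzero, while the finitely many
  -- strict inequalities survive.
  have hne : ∀ x : ℝ, ∀ᶠ t in nhdsWithin (0 : ℝ) {0}ᶜ, x + t ≠ 0 := by
    intro x
    rcases eq_or_ne x 0 with rfl | hx
    · filter_upwards [self_mem_nhdsWithin] with t ht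
      simpa using ht
    · have hc : Tendsto (fun t : ℝ => x + t) (nhds 0) (nhds (x + 0)) :=
        (continuous_const.add continuous_id).tendsto 0
      exact (hc.eventually_ne (by simpa using hx)).filter_mono nhdsWithin_le_nhds
  have hlt : ∀ᶠ t in nhdsWithin (0 : ℝ) {0}ᶜ, ∀ q ∈ V, q ≠ p →
      (a + t) * q.1 + (b + t) * q.2 < (a + t) * p.1 + (b + t) * p.2 := by
    refine Filter.Eventually.filter_mono nhdsWithin_le_nhds
      ((Finset.eventually_all V).2 fun q hq => ?_)
    by_cases hqp : q = p
    · exact Eventually.of_forall fun t h => absurd hqp h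
    · have h1 : Tendsto (fun t : ℝ => (a + t) * q.1 + (b + t) * q.2) (nhds 0)
          (nhds ((a + 0) * q.1 + (b + 0) * q.2)) :=
        Continuous.tendsto (by fun_prop) 0
      have h2 : Tendsto (fun t : ℝ => (a + t) * p.1 + (b + t) * p.2) (nhds 0)
          (nhds ((a + 0) * p.1 + (b + 0) * p.2)) :=
        Continuous.tendsto (by fun_prop) 0
      exact (h1.eventually_lt h2 (by simpa using hab q hq hqp)).mono fun t ht _ => ht
  obtain ⟨t, ha, hb, ht⟩ := ((hne a).and ((hne b).and hlt)).exists
  have hsgn : ∀ x : ℝ, x ≠ 0 → ∃ c : Bool, sgn c * |x| = x := by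
    intro x hx
    rcases hx.lt_or_gt with h | h
    · exact ⟨false, by simp [sgn, abs_of_neg h]⟩
    · exact ⟨true, by simp [sgn, abs_of_pos h]⟩
  obtain ⟨c, hc⟩ := hsgn _ ha
  obtain ⟨d, hd⟩ := hsgn _ hb
  refine ⟨(c, d), |a + t|, abs_pos.2 ha, |b + t|, abs_pos.2 hb, fun q hq => ?_⟩
  simp only [← mul_assoc, hc, hd]
  rcases eq_or_ne q p with rfl | hqp
  · exact le_rfl
  · exact (ht q hq hqp).le

/-- Otherwise the step from one of the two points to the other would go weakly outwards in both
coordinates. As the weights are positive, maximality at the inner point would force the points to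
coincide. -/
theorem InQuadrant.sgn_mul_snd_lt {V : Finset (ℝ × ℝ)} {c : Bool × Bool} {p q : ℝ × ℝ}
    (hp : p ∈ V) (hq : q ∈ V) (hpc : InQuadrant V c p) (hqc : InQuadrant V c q) (hne : p ≠ q)
    (hle : p.1 ≤ q.1) : sgn c.1 * sgn c.2 * q.2 < sgn c.1 * sgn c.2 * p.2 := by
  obtain ⟨a, ha, b, hb, h⟩ := hpc
  obtain ⟨a', ha', b', hb', h'⟩ := hqc
  have h1 := h q hq
  have h2 := h' p hp
  by_contra hlt
  push Not at hlt
  apply hne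
  obtain ⟨c, d⟩ := c
  cases c <;> cases d <;> simp only [sgn, if_true, if_false, Bool.false_eq_true] at h1 h2 hlt
  · have e : p.1 = q.1 := by nlinarith
    exact Prod.ext e (by rw [e] at h1 h2; nlinarith)
  · have e : p.1 = q.1 := by nlinarith
    exact Prod.ext e (by rw [e] at h1 h2; nlinarith)
  · have e : p.1 = q.1 := by nlinarith
    exact Prod.ext e (by rw [e] at h1 h2; nlinarith)
  · have e : p.1 = q.1 := by nlinarith
    exact Prod.ext e (by rw [e] at h1 h2; nlinarith)

/-- If q were weakly to the left of p, maximality of p would bound the signed height of q by that of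
p, and maximality of q would give the converse. With equal heights, the abscissae agree as well. -/
theorem InQuadrant.fst_lt_fst {V : Finset (ℝ × ℝ)} {d : Bool} {p q : ℝ × ℝ}
    (hp : p ∈ V) (hq : q ∈ V) (hpc : InQuadrant V (false, d) p) (hqc : InQuadrant V (true, d) q)
    (hne : p ≠ q) : p.1 < q.1 := by
  obtain ⟨a, ha, b, hb, h⟩ := hpc
  obtain ⟨a', ha', b', hb', h'⟩ := hqc
  have h1 := h q hq
  have h2 := h' p hp
  by_contra hlt
  push Not at hlt
  apply hne
  have hm := mul_le_mul_of_nonneg_left hlt ha.le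
  have hm' := mul_le_mul_of_nonneg_left hlt ha'.le
  cases d <;> simp only [sgn, if_true, if_false, Bool.false_eq_true] at h1 h2
  · have e2 : p.2 = q.2 :=
      le_antisymm (le_of_mul_le_mul_left (by linarith) hb) (le_of_mul_le_mul_left (by linarith) hb')
    rw [e2] at h1 h2
    exact Prod.ext (le_antisymm (le_of_mul_le_mul_left (by linarith) ha') hlt) e2
  · have e2 : p.2 = q.2 :=
      le_antisymm (le_of_mul_le_mul_left (by linarith) hb') (le_of_mul_le_mul_left (by linarith) hb)
    rw [e2] at h1 h2
    exact Prod.ext (le_antisymm (le_of_mul_le_mul_left (by linarith) ha') hlt) e2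

theorem InQuadrant.swap {V : Finset (ℝ × ℝ)} {c : Bool × Bool} {p : ℝ × ℝ}
    (h : InQuadrant V c p) : InQuadrant (V.image Prod.swap) c.swap p.swap := by
  obtain ⟨a, ha, b, hb, h⟩ := h
  refine ⟨b, hb, a, ha, fun q hq => ?_⟩
  obtain ⟨r, hr, rfl⟩ := Finset.mem_image.1 hq
  simpa [add_comm] using h r hr

theorem InQuadrant.snd_lt_snd {V : Finset (ℝ × ℝ)} {d : Bool} {p q : ℝ × ℝ}
    (hp : p ∈ V) (hq : q ∈ V) (hpc : InQuadrant V (d, false) p) (hqc : InQuadrant V (d, true) q)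
    (hne : p ≠ q) : p.2 < q.2 :=
  InQuadrant.fst_lt_fst (p := p.swap) (q := q.swap) (Finset.mem_image_of_mem _ hp)
    (Finset.mem_image_of_mem _ hq) hpc.swap hqc.swap fun h => hne (Prod.swap_injective h)

/-! ### Monotone chains and their projections -/

/-- A strictly monotone chain (increasing or decreasing, according to the sign of `s`). -/
def IsChainOfSign (s : ℝ) (C : Finset (ℝ × ℝ)) : Prop :=
  ∀ p ∈ C, ∀ q ∈ C, p ≠ q → p.1 ≤ q.1 → s * q.2 < s * p.2

/-- Both sides count the members of the chain strictly to the right of p, because both projections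
are injective on a chain. -/
theorem IsChainOfSign.card_filter {s : ℝ} {C : Finset (ℝ × ℝ)} (hC : IsChainOfSign s C)
    {p : ℝ × ℝ} (hp : p ∈ C) :
    ((C.image Prod.fst).filter (p.1 < ·)).card
      = ((C.image Prod.snd).filter fun y => s * y < s * p.2).card := by
  have hiff : ∀ q ∈ C, p.1 < q.1 ↔ s * q.2 < s * p.2 := by
    intro q hq
    constructor
    · intro h
      exact hC p hp q hq (fun e => h.ne (by rw [e])) h.le
    · intro h
      by_contra hle
      push Not at hle
      have hne : q ≠ p := fun e => h.ne (by rw [e])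
      exact (hC q hq p hp hne hle).not_gt h
  rw [Finset.filter_image, Finset.filter_image, Finset.card_image_of_injOn,
    Finset.card_image_of_injOn, Finset.filter_congr hiff]
  · intro q hq r hr h
    simp only [Finset.coe_filter, Set.mem_ofPred_eq] at hq hr
    by_contra hne
    rcases le_total q.1 r.1 with hle | hle
    · exact (hC q hq.1 r hr.1 hne hle).ne (by rw [show q.2 = r.2 from h])
    · exact (hC r hr.1 q hq.1 (Ne.symm hne) hle).ne (by rw [show q.2 = r.2 from h])
  · intro q hq r hr h
    simp only [Finset.coe_filter, Set.mem_ofPred_eq] at hq hr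
    by_contra hne
    exact lt_asymm (hC q hq.1 r hr.1 hne (le_of_eq h))
      (hC r hr.1 q hq.1 (Ne.symm hne) (le_of_eq (Eq.symm h)))

theorem eq_of_card_filter_lt_eq {α β : Type*} [LinearOrder β] {f : α → β} {B : Finset α}
    {y z : α} (hf : Function.Injective f) (hy : y ∈ B) (hz : z ∈ B)
    (h : (B.filter fun b => f b < f y).card = (B.filter fun b => f b < f z).card) : y = z := by
  have key : ∀ u v : α, u ∈ B → f u < f v →
      (B.filter fun b => f b < f u).card < (B.filter fun b => f b < f v).card := by
    intro u v hu huv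
    refine Finset.card_lt_card ((Finset.ssubset_iff_of_subset ?_).2 ⟨u, by simp [hu, huv], by simp⟩)
    intro b hb
    simp only [Finset.mem_filter] at hb ⊢
    exact ⟨hb.1, hb.2.trans huv⟩
  rcases lt_trichotomy (f y) (f z) with hlt | heq | hlt
  · exact absurd h (key y z hy hlt).ne
  · exact hf heq
  · exact absurd h (key z y hz hlt).ne'

/-- The abscissa of a point fixes its rank in the chain, and this rank fixes its ordinate among the
projected values. -/
theorem IsChainOfSign.subset {s : ℝ} (hs : s ≠ 0) {C D : Finset (ℝ × ℝ)} (hC : IsChainOfSign s C)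
    (hD : IsChainOfSign s D) (h1 : C.image Prod.fst = D.image Prod.fst)
    (h2 : C.image Prod.snd = D.image Prod.snd) : C ⊆ D := by
  intro p hp
  have : p.1 ∈ D.image Prod.fst := h1 ▸ Finset.mem_image_of_mem _ hp
  obtain ⟨q, hq, hqp⟩ := Finset.mem_image.1 this
  have e := hC.card_filter hp
  have e' := hD.card_filter hq
  rw [h1, h2, ← hqp, e'] at e
  have := eq_of_card_filter_lt_eq (f := fun y : ℝ => s * y)
    (mul_right_injective₀ hs) (Finset.mem_image_of_mem _ hq)
    (h2 ▸ Finset.mem_image_of_mem Prod.snd hp) e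
  rwa [← Prod.ext hqp this]

/-- A and A' are initial segments of the same set with the same size. -/
theorem eq_of_union_eq_of_card_eq {α : Type*} [LinearOrder α] {A B A' B' : Finset α}
    (h : ∀ a ∈ A, ∀ b ∈ B, a < b) (h' : ∀ a ∈ A', ∀ b ∈ B', a < b) (hU : A ∪ B = A' ∪ B')
    (hc : A.card = A'.card) : A = A' ∧ B = B' := by
  have hsub : A ⊆ A' := by
    intro x hx
    by_contra hx'
    have hxB : x ∈ B' := by
      have : x ∈ A' ∪ B' := hU ▸ Finset.mem_union_left _ hx
      exact (Finset.mem_union.1 this).resolve_left hx'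
    have hs : A' ⊆ A := by
      intro y hy
      have : y ∈ A ∪ B := hU ▸ Finset.mem_union_left _ hy
      exact (Finset.mem_union.1 this).resolve_right fun hyB =>
        lt_asymm (h x hx y hyB) (h' y hy x hxB)
    exact hx' (Finset.eq_of_subset_of_card_le hs hc.le ▸ hx)
  have hA : A = A' := Finset.eq_of_subset_of_card_le hsub hc.ge
  have hd : Disjoint A B := Finset.disjoint_left.2 fun a ha hb => lt_irrefl a (h a ha a hb)
  have hd' : Disjoint A' B' := Finset.disjoint_left.2 fun a ha hb => lt_irrefl a (h' a ha a hb)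
  refine ⟨hA, ?_⟩
  rw [← Finset.union_sdiff_cancel_left hd, hU, hA, Finset.union_sdiff_cancel_left hd']

/-! ### Encoding labelled vertex sets -/

/-- The part of `V` with label `c`. -/
noncomputable def part (V : Finset (ℝ × ℝ)) (κ : ℝ × ℝ → Bool × Bool) (c : Bool × Bool) : Finset (ℝ × ℝ) :=
  V.filter fun p => κ p = c

theorem mem_part {V : Finset (ℝ × ℝ)} {κ : ℝ × ℝ → Bool × Bool} {c : Bool × Bool} {p : ℝ × ℝ} :
    p ∈ part V κ c ↔ p ∈ V ∧ κ p = c := by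
  simp [part]

/-- The abscissae of the part of `V` with label `(σ, τ)`. -/
noncomputable def partX (V : Finset (ℝ × ℝ)) (κ : ℝ × ℝ → Bool × Bool) (τ σ : Bool) : Finset ℝ :=
  (part V κ (σ, τ)).image Prod.fst

/-- The ordinates of the part of `V` with label `(σ, τ)`. -/
noncomputable def partY (V : Finset (ℝ × ℝ)) (κ : ℝ × ℝ → Bool × Bool) (σ τ : Bool) : Finset ℝ :=
  (part V κ (σ, τ)).image Prod.snd

/-- Two unions of consecutive blocks, together with the sizes of the first blocks. -/
noncomputable def blockCode (A : Bool → Bool → Finset ℝ) : (Finset ℝ × Finset ℝ) × (ℕ × ℕ) :=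
  ((A true false ∪ A true true, A false false ∪ A false true),
    ((A true false).card, (A false false).card))

theorem blockCode_injOn {A A' : Bool → Bool → Finset ℝ}
    (h : ∀ τ, ∀ a ∈ A τ false, ∀ b ∈ A τ true, a < b)
    (h' : ∀ τ, ∀ a ∈ A' τ false, ∀ b ∈ A' τ true, a < b) (e : blockCode A = blockCode A') :
    A = A' := by
  simp only [blockCode, Prod.mk.injEq] at e
  obtain ⟨⟨e1, e2⟩, e3, e4⟩ := e
  obtain ⟨h1, h2⟩ := eq_of_union_eq_of_card_eq (h true) (h' true) e1 e3
  obtain ⟨h3, h4⟩ := eq_of_union_eq_of_card_eq (h false) (h' false) e2 e4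
  funext τ σ
  cases τ <;> cases σ <;> assumption

/-- The label of every point of `V` is a quadrant of directions in which it is extreme. -/
def IsQuadrantLabelling (V : Finset (ℝ × ℝ)) (κ : ℝ × ℝ → Bool × Bool) : Prop :=
  ∀ p ∈ V, InQuadrant V (κ p) p

theorem IsQuadrantLabelling.partX_lt {V : Finset (ℝ × ℝ)} {κ : ℝ × ℝ → Bool × Bool}
    (h : IsQuadrantLabelling V κ) (τ : Bool) :
    ∀ a ∈ partX V κ τ false, ∀ b ∈ partX V κ τ true, a < b := by
  intro a ha b hb
  obtain ⟨p, hp, rfl⟩ := Finset.mem_image.1 ha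
  obtain ⟨q, hq, rfl⟩ := Finset.mem_image.1 hb
  obtain ⟨hp, hpk⟩ := mem_part.1 hp
  obtain ⟨hq, hqk⟩ := mem_part.1 hq
  refine InQuadrant.fst_lt_fst hp hq (hpk ▸ h p hp) (hqk ▸ h q hq) ?_
  rintro rfl
  simp [hpk] at hqk

theorem IsQuadrantLabelling.partY_lt {V : Finset (ℝ × ℝ)} {κ : ℝ × ℝ → Bool × Bool}
    (h : IsQuadrantLabelling V κ) (σ : Bool) :
    ∀ a ∈ partY V κ σ false, ∀ b ∈ partY V κ σ true, a < b := by
  intro a ha b hb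
  obtain ⟨p, hp, rfl⟩ := Finset.mem_image.1 ha
  obtain ⟨q, hq, rfl⟩ := Finset.mem_image.1 hb
  obtain ⟨hp, hpk⟩ := mem_part.1 hp
  obtain ⟨hq, hqk⟩ := mem_part.1 hq
  refine InQuadrant.snd_lt_snd hp hq (hpk ▸ h p hp) (hqk ▸ h q hq) ?_
  rintro rfl
  simp [hpk] at hqk

theorem IsQuadrantLabelling.isChainOfSign_part {V : Finset (ℝ × ℝ)} {κ : ℝ × ℝ → Bool × Bool}
    (h : IsQuadrantLabelling V κ) (c : Bool × Bool) :
    IsChainOfSign (sgn c.1 * sgn c.2) (part V κ c) := by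
  intro p hp q hq hne hle
  obtain ⟨hp, hpk⟩ := mem_part.1 hp
  obtain ⟨hq, hqk⟩ := mem_part.1 hq
  exact InQuadrant.sgn_mul_snd_lt hp hq (hpk ▸ h p hp) (hqk ▸ h q hq) hne hle

theorem IsQuadrantLabelling.subset {V V' : Finset (ℝ × ℝ)} {κ κ' : ℝ × ℝ → Bool × Bool}
    (h : IsQuadrantLabelling V κ) (h' : IsQuadrantLabelling V' κ')
    (hX : partX V κ = partX V' κ') (hY : partY V κ = partY V' κ') : V ⊆ V' := by
  intro p hp
  have hs : ∀ b, sgn b ≠ 0 := fun b => by cases b <;> simp [sgn]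
  have := (h.isChainOfSign_part (κ p)).subset (mul_ne_zero (hs _) (hs _))
    (h'.isChainOfSign_part (κ p)) (congrFun (congrFun hX (κ p).2) (κ p).1)
    (congrFun (congrFun hY (κ p).1) (κ p).2) (mem_part.2 ⟨hp, rfl⟩)
  exact (mem_part.1 this).1

/-- The code of a labelled point set, which determines the set. -/
noncomputable def polygonCode (V : Finset (ℝ × ℝ)) (κ : ℝ × ℝ → Bool × Bool) :
    ((Finset ℝ × Finset ℝ) × (ℕ × ℕ)) × ((Finset ℝ × Finset ℝ) × (ℕ × ℕ)) :=
  (blockCode (partX V κ), blockCode (partY V κ))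

theorem IsQuadrantLabelling.eq_of_polygonCode_eq {V V' : Finset (ℝ × ℝ)}
    {κ κ' : ℝ × ℝ → Bool × Bool} (h : IsQuadrantLabelling V κ) (h' : IsQuadrantLabelling V' κ')
    (e : polygonCode V κ = polygonCode V' κ') : V = V' := by
  simp only [polygonCode, Prod.mk.injEq] at e
  have hX := blockCode_injOn h.partX_lt h'.partX_lt e.1
  have hY := blockCode_injOn h.partY_lt h'.partY_lt e.2
  exact (h.subset h' hX hY).antisymm (h'.subset h hX.symm hY.symm)

theorem blockCode_mem {cover disj : Bool} {X : Finset ℝ} {A : Bool → Bool → Finset ℝ}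
    (hs : ∀ τ σ, A τ σ ⊆ X) (hc : cover → ∀ x ∈ X, ∃ τ σ, x ∈ A τ σ)
    (hd : disj → ∀ x σ σ', x ∈ A true σ → x ∈ A false σ' → False) :
    blockCode A ∈ labelPairs cover disj X ×ˢ
      (Finset.range (X.card + 1) ×ˢ Finset.range (X.card + 1)) := by
  have hl : ∀ τ, A τ false ∪ A τ true ⊆ X := fun τ => Finset.union_subset (hs _ _) (hs _ _)
  simp only [blockCode, Finset.mem_product, Finset.mem_range, Nat.lt_succ_iff]
  refine ⟨mem_labelPairs.2 ⟨⟨hl _, hl _⟩, fun h => ?_, fun h => ?_⟩,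
    Finset.card_le_card (hs _ _), Finset.card_le_card (hs _ _)⟩
  · refine (Finset.union_subset (hl _) (hl _)).antisymm fun x hx => ?_
    obtain ⟨τ, σ, hx⟩ := hc h x hx
    cases τ <;> cases σ <;> simp [hx]
  · rw [Finset.disjoint_left]
    intro x hx hx'
    rcases Finset.mem_union.1 hx with h1 | h1 <;> rcases Finset.mem_union.1 hx' with h2 | h2 <;>
      exact hd h x _ _ h1 h2

/-- An extreme point of a convex set is not in the hull of the remaining points, so it is strictly
separated from the other vertices. -/
theorem exists_vertices_labelling {X Y : Finset ℝ} {P : Set (ℝ × ℝ)} (hg : GridContains X Y P) :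
    ∃ (V : Finset (ℝ × ℝ)) (κ : ℝ × ℝ → Bool × Bool), (V : Set (ℝ × ℝ)) = vertices P ∧
      (Convex ℝ P → IsQuadrantLabelling V κ) := by
  have hs : vertices P ⊆ ((X ×ˢ Y : Finset (ℝ × ℝ)) : Set (ℝ × ℝ)) := fun v hv => by
    simpa using hg v hv
  obtain ⟨V, hV⟩ := ((X ×ˢ Y).finite_toSet.subset hs).exists_finset_coe
  by_cases hP : Convex ℝ P
  · have : ∀ p, ∃ c, p ∈ V → InQuadrant V c p := by
      intro p
      by_cases hp : p ∈ V
      · have hpP : p ∈ vertices P := hV ▸ hp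
        have hn : p ∉ convexHull ℝ ((V : Set (ℝ × ℝ)) \ {p}) := fun h =>
          (hP.mem_extremePoints_iff_mem_sdiff_convexHull_sdiff.1 hpP).2
            (convexHull_mono (Set.sdiff_subset_sdiff_left (hV ▸ extremePoints_subset)) h)
        obtain ⟨c, hc⟩ := exists_inQuadrant hn
        exact ⟨c, fun _ => hc⟩
      · exact ⟨(true, true), fun h => absurd h hp⟩
    choose κ hκ using this
    exact ⟨V, κ, hV, fun _ p hp => hκ p hp⟩
  · exact ⟨V, fun _ => (true, true), hV, fun h => absurd h hP⟩

theorem ncard_polygonsOfKind_le (cover disj : Bool) (X Y : Finset ℝ) :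
    (polygonsOfKind cover disj X Y).ncard ≤
      ((labels cover disj).card ^ X.card * ((X.card + 1) * (X.card + 1))) *
      ((labels cover disj).card ^ Y.card * ((Y.card + 1) * (Y.card + 1))) := by
  have hex : ∀ P : Set (ℝ × ℝ), ∃ (V : Finset (ℝ × ℝ)) (κ : ℝ × ℝ → Bool × Bool),
      P ∈ polygonsOfKind cover disj X Y →
        (V : Set (ℝ × ℝ)) = vertices P ∧ IsQuadrantLabelling V κ := by
    intro P
    by_cases hP : P ∈ polygonsOfKind cover disj X Y
    · obtain ⟨V, κ, hV, hκ⟩ := exists_vertices_labelling hP.2.1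
      obtain ⟨S, hS⟩ := hP.1.1
      exact ⟨V, κ, fun _ => ⟨hV, hκ (hS ▸ convex_convexHull ℝ _)⟩⟩
    · exact ⟨∅, fun _ => (true, true), fun h => absurd h hP⟩
  choose V κ hVκ using hex
  set T := (labelPairs cover disj X ×ˢ
      (Finset.range (X.card + 1) ×ˢ Finset.range (X.card + 1))) ×ˢ
    (labelPairs cover disj Y ×ˢ (Finset.range (Y.card + 1) ×ˢ Finset.range (Y.card + 1))) with hT
  have hcard : T.card = ((labels cover disj).card ^ X.card * ((X.card + 1) * (X.card + 1))) *
      ((labels cover disj).card ^ Y.card * ((Y.card + 1) * (Y.card + 1))) := by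
    simp only [hT, Finset.card_product, card_labelPairs, Finset.card_range]
  rw [← hcard, ← Set.ncard_coe_finset]
  refine Set.ncard_le_ncard_of_injOn (fun P => polygonCode (V P) (κ P)) ?_ ?_ T.finite_toSet
  · intro P hP
    obtain ⟨hV, hκ⟩ := hVκ P hP
    obtain ⟨-, hg, hc, hd⟩ := hP
    have hmem : ∀ p, p ∈ V P ↔ p ∈ vertices P := fun p => by rw [← hV]; rfl
    rw [Finset.mem_coe, hT, Finset.mem_product]
    refine ⟨blockCode_mem (fun τ σ x hx => ?_) (fun h x hx => ?_) (fun h x σ σ' h1 h2 => ?_),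
      blockCode_mem (fun τ σ x hx => ?_) (fun h x hx => ?_) (fun h x σ σ' h1 h2 => ?_)⟩
    · obtain ⟨p, hp, rfl⟩ := Finset.mem_image.1 hx
      exact (hg p ((hmem p).1 (mem_part.1 hp).1)).1
    · obtain ⟨v, hv, rfl⟩ := (hc h).1 x hx
      exact ⟨(κ P v).2, (κ P v).1, Finset.mem_image_of_mem _ (mem_part.2 ⟨(hmem v).2 hv, rfl⟩)⟩
    · obtain ⟨p, hp, rfl⟩ := Finset.mem_image.1 h1
      obtain ⟨q, hq, hqp⟩ := Finset.mem_image.1 h2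
      obtain ⟨hp, hpk⟩ := mem_part.1 hp
      obtain ⟨hq, hqk⟩ := mem_part.1 hq
      -- Two vertices on one vertical line coincide, so they cannot carry labels with different
      -- vertical signs.
      obtain rfl := hd h p ((hmem p).1 hp) q ((hmem q).1 hq) (Or.inl hqp.symm)
      simp [hpk] at hqk
    · obtain ⟨p, hp, rfl⟩ := Finset.mem_image.1 hx
      exact (hg p ((hmem p).1 (mem_part.1 hp).1)).2
    · obtain ⟨v, hv, rfl⟩ := (hc h).2 x hx
      exact ⟨(κ P v).1, (κ P v).2, Finset.mem_image_of_mem _ (mem_part.2 ⟨(hmem v).2 hv, rfl⟩)⟩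
    · obtain ⟨p, hp, rfl⟩ := Finset.mem_image.1 h1
      obtain ⟨q, hq, hqp⟩ := Finset.mem_image.1 h2
      obtain ⟨hp, hpk⟩ := mem_part.1 hp
      obtain ⟨hq, hqk⟩ := mem_part.1 hq
      obtain rfl := hd h p ((hmem p).1 hp) q ((hmem q).1 hq) (Or.inr hqp.symm)
      simp [hpk] at hqk
  · intro P hP Q hQ e
    obtain ⟨hV, hκ⟩ := hVκ P hP
    obtain ⟨hV', hκ'⟩ := hVκ Q hQ
    have := hκ.eq_of_polygonCode_eq hκ' e
    rw [hP.1.eq_convexHull, hQ.1.eq_convexHull, ← hV, ← hV', this]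

/-! ### Polygons from points in convex position -/

/-- The hull is generated by its extreme points, which are among V. If p were not one of them, it
would lie in the hull of the other points, where its functional is strictly smaller. -/
theorem vertices_convexHull_eq {V : Finset (ℝ × ℝ)}
    (h : ∀ p ∈ V, ∃ a b : ℝ, ∀ q ∈ V, q ≠ p → a * q.1 + b * q.2 < a * p.1 + b * p.2) :
    vertices (convexHull ℝ (V : Set (ℝ × ℝ))) = V := by
  refine Set.Subset.antisymm extremePoints_convexHull_subset fun p hp => ?_
  by_contra hn
  have hsub : vertices (convexHull ℝ (V : Set (ℝ × ℝ))) ⊆ (V : Set (ℝ × ℝ)) \ {p} := fun q hq =>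
    ⟨extremePoints_convexHull_subset hq, fun e => hn (e ▸ hq)⟩
  have hfin : (vertices (convexHull ℝ (V : Set (ℝ × ℝ)))).Finite :=
    V.finite_toSet.subset extremePoints_convexHull_subset
  have hK := closure_convexHull_extremePoints (V.finite_toSet.isCompact_convexHull (𝕜 := ℝ))
    (convex_convexHull ℝ (V : Set (ℝ × ℝ)))
  change closure (convexHull ℝ (vertices _)) = _ at hK
  rw [(hfin.isCompact_convexHull (𝕜 := ℝ)).isClosed.closure_eq] at hK
  have hpm : p ∈ convexHull ℝ ((V : Set (ℝ × ℝ)) \ {p}) :=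
    convexHull_mono hsub (hK.symm ▸ subset_convexHull ℝ _ hp)
  obtain ⟨a, b, hab⟩ := h p hp
  have hconv : Convex ℝ {q : ℝ × ℝ | a * q.1 + b * q.2 < a * p.1 + b * p.2} :=
    convex_halfSpace_lt (f := fun q : ℝ × ℝ => a * q.1 + b * q.2)
      ⟨fun x y => by simp only [Prod.fst_add, Prod.snd_add]; ring,
        fun c x => by simp only [Prod.smul_fst, Prod.smul_snd, smul_eq_mul]; ring⟩ _
  have hlt : a * p.1 + b * p.2 < a * p.1 + b * p.2 :=
    convexHull_min (fun q hq => hab q hq.1 hq.2) hconv hpm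
  exact lt_irrefl _ hlt

/-- Among three collinear points one lies between the other two and is not extreme. Hence any three
vertices are affinely independent and span the plane. -/
theorem isConvexPolygon_convexHull {V : Finset (ℝ × ℝ)}
    (h : vertices (convexHull ℝ (V : Set (ℝ × ℝ))) = V) (hc : 3 ≤ V.card) :
    IsConvexPolygon (convexHull ℝ (V : Set (ℝ × ℝ))) := by
  refine ⟨⟨V, rfl⟩, ?_⟩
  rw [interior_convexHull_nonempty_iff_affineSpan_eq_top]
  obtain ⟨p, hp, q, hq, r, hr, hpq, hpr, hqr⟩ := Finset.two_lt_card.1 hc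
  have hbtw : ∀ x ∈ V, ∀ y ∈ V, ∀ z ∈ V, x ≠ y → z ≠ y → ¬ Wbtw ℝ x y z := by
    intro x hx y hy z hz hxy hzy hw
    have hyv : y ∈ (convexHull ℝ (V : Set (ℝ × ℝ))).extremePoints ℝ := by
      change y ∈ vertices _
      rw [h]; exact hy
    rcases (mem_extremePoints_iff_forall_segment.1 hyv).2 x (subset_convexHull ℝ _ hx) z
      (subset_convexHull ℝ _ hz) (mem_segment_iff_wbtw.2 hw) with e | e
    exacts [hxy e, hzy e]
  have hncol : ¬ Collinear ℝ ({p, q, r} : Set (ℝ × ℝ)) := by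
    intro hcol
    rcases hcol.wbtw_or_wbtw_or_wbtw with hw | hw | hw
    · exact hbtw p hp q hq r hr hpq hqr.symm hw
    · exact hbtw q hq r hr p hp hqr hpr hw
    · exact hbtw r hr p hp q hq hpr.symm hpq.symm hw
  have hai := affineIndependent_iff_not_collinear_set.2 hncol
  have htop := hai.affineSpan_eq_top_iff_card_eq_finrank_add_one.2 (by simp)
  rw [eq_top_iff, ← htop]
  refine affineSpan_mono ℝ ?_
  rintro _ ⟨i, rfl⟩
  fin_cases i <;> simp [hp, hq, hr]

/-! ### The grid for the lower bound -/

/-- The abscissa of the `i`-th grid line, counted outwards, on the side given by `σ`. The gaps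
between consecutive lines shrink geometrically. -/
noncomputable def abscissa (K : ℝ) (σ : Bool) (i : ℕ) : ℝ := sgn σ * (1 - (K ^ (i + 1))⁻¹)

/-- The ordinate of the `j`-th grid line, counted outwards, on the side given by `τ`. -/
noncomputable def ordinate (τ : Bool) (j : ℕ) : ℝ := sgn τ * (j + 1)

/-- The grid point in column `i` and row `j` of the quadrant `(σ, τ)`. -/
noncomputable def gridPoint (K : ℝ) (t : Bool × Bool × ℕ × ℕ) : ℝ × ℝ :=
  (abscissa K t.1 t.2.2.1, ordinate t.2.1 t.2.2.2)

theorem eq_of_sgn_mul_eq {σ σ' : Bool} {x y : ℝ} (hx : 0 < x) (hy : 0 < y)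
    (h : sgn σ * x = sgn σ' * y) : σ = σ' ∧ x = y := by
  cases σ <;> cases σ' <;> simp only [sgn, if_true, if_false, Bool.false_eq_true] at h <;>
    first
    | exact ⟨rfl, by linarith⟩
    | exact absurd h (by linarith)

theorem abscissa_injective {K : ℝ} (hK : 1 < K) {σ σ' : Bool} {i i' : ℕ}
    (h : abscissa K σ i = abscissa K σ' i') : σ = σ' ∧ i = i' := by
  have hpos : ∀ k : ℕ, 0 < 1 - (K ^ (k + 1))⁻¹ := fun k =>
    sub_pos.2 (inv_lt_one_of_one_lt₀ (one_lt_pow₀ hK (Nat.succ_ne_zero k)))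
  obtain ⟨h1, h2⟩ := eq_of_sgn_mul_eq (hpos i) (hpos i') h
  have h3 : K ^ (i + 1) = K ^ (i' + 1) := inv_injective (by linarith)
  have := pow_right_injective₀ (zero_lt_one.trans hK) hK.ne' h3
  exact ⟨h1, by omega⟩

theorem ordinate_injective {τ τ' : Bool} {j j' : ℕ} (h : ordinate τ j = ordinate τ' j') :
    τ = τ' ∧ j = j' := by
  obtain ⟨h1, h2⟩ := eq_of_sgn_mul_eq (by positivity) (by positivity) h
  exact ⟨h1, by exact_mod_cast add_right_cancel h2⟩

theorem gridPoint_injective {K : ℝ} (hK : 1 < K) : Function.Injective (gridPoint K) := by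
  rintro ⟨σ, τ, i, j⟩ ⟨σ', τ', i', j'⟩ h
  simp only [gridPoint, Prod.mk.injEq] at h
  obtain ⟨rfl, rfl⟩ := abscissa_injective hK h.1
  obtain ⟨rfl, rfl⟩ := ordinate_injective h.2
  rfl

/-- The rank is an injection from B into the numbers below `B.card`, hence surjective by counting.
-/
theorem exists_card_filter_lt_eq {α β : Type*} [LinearOrder β] {f : α → β} {B : Finset α}
    (hf : Function.Injective f) {k : ℕ} (hk : k < B.card) :
    ∃ y ∈ B, (B.filter fun b => f b < f y).card = k := by
  have hmaps : Set.MapsTo (fun y => (B.filter fun b => f b < f y).card) B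
      (Finset.range B.card) := by
    intro y hy
    refine Finset.mem_coe.2 (Finset.mem_range.2 (Finset.card_lt_card ?_))
    exact (Finset.ssubset_iff_of_subset (Finset.filter_subset _ _)).2 ⟨y, hy, by simp⟩
  have hsurj := Finset.surjOn_of_injOn_of_card_le _ hmaps
    (fun y hy z hz h => eq_of_card_filter_lt_eq hf hy hz h) (by simp)
  obtain ⟨y, hy, h⟩ := hsurj (Finset.mem_coe.2 (Finset.mem_range.2 hk))
  exact ⟨y, hy, h⟩

/-! ### Order-reversing matchings in the four quadrants -/

/-- The order-reversing matching of two finite sets of the same size. -/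
def antitoneMatching (A B : Finset ℕ) : Finset (ℕ × ℕ) :=
  (A ×ˢ B).filter fun p => (A.filter (p.1 < ·)).card = (B.filter (· < p.2)).card

theorem mem_antitoneMatching {A B : Finset ℕ} {i j : ℕ} :
    (i, j) ∈ antitoneMatching A B ↔
      (i ∈ A ∧ j ∈ B) ∧ (A.filter (i < ·)).card = (B.filter (· < j)).card := by
  simp [antitoneMatching]

theorem exists_mem_antitoneMatching_left {A B : Finset ℕ} (h : A.card = B.card) {i : ℕ}
    (hi : i ∈ A) : ∃ j, (i, j) ∈ antitoneMatching A B := by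
  have hlt : (A.filter (i < ·)).card < B.card := h ▸ Finset.card_lt_card
    ((Finset.ssubset_iff_of_subset (Finset.filter_subset _ _)).2 ⟨i, hi, by simp⟩)
  obtain ⟨j, hj, e⟩ := exists_card_filter_lt_eq (f := fun x : ℕ => x) (fun _ _ h => h) hlt
  exact ⟨j, mem_antitoneMatching.2 ⟨⟨hi, hj⟩, e.symm⟩⟩

theorem exists_mem_antitoneMatching_right {A B : Finset ℕ} (h : A.card = B.card) {j : ℕ}
    (hj : j ∈ B) : ∃ i, (i, j) ∈ antitoneMatching A B := by
  have hlt : (B.filter (· < j)).card < A.card := h ▸ Finset.card_lt_card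
    ((Finset.ssubset_iff_of_subset (Finset.filter_subset _ _)).2 ⟨j, hj, by simp⟩)
  -- Ranks in A are counted from above, hence the dual order.
  obtain ⟨i, hi, e⟩ := exists_card_filter_lt_eq (f := OrderDual.toDual)
    OrderDual.toDual.injective hlt
  exact ⟨i, mem_antitoneMatching.2 ⟨⟨hi, hj⟩, e⟩⟩

theorem antitoneMatching_snd_lt {A B : Finset ℕ} {i j i' j' : ℕ}
    (h : (i, j) ∈ antitoneMatching A B) (h' : (i', j') ∈ antitoneMatching A B) (hle : i ≤ i')
    (hne : (i, j) ≠ (i', j')) : j' < j := by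
  obtain ⟨⟨hi, hj⟩, e⟩ := mem_antitoneMatching.1 h
  obtain ⟨⟨hi', hj'⟩, e'⟩ := mem_antitoneMatching.1 h'
  rcases hle.eq_or_lt with rfl | hlt
  · refine absurd ?_ hne
    rw [eq_of_card_filter_lt_eq (f := fun x : ℕ => x) (fun _ _ h => h) hj hj' (e.symm.trans e')]
  · by_contra hle'
    push Not at hle'
    have h1 : (A.filter (i' < ·)).card < (A.filter (i < ·)).card := by
      refine Finset.card_lt_card ((Finset.ssubset_iff_of_subset fun b hb => ?_).2
        ⟨i', by simp [hi', hlt], by simp⟩)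
      simp only [Finset.mem_filter] at hb ⊢
      exact ⟨hb.1, hlt.trans hb.2⟩
    have h2 : (B.filter (· < j)).card ≤ (B.filter (· < j')).card := by
      refine Finset.card_le_card fun b hb => ?_
      simp only [Finset.mem_filter] at hb ⊢
      exact ⟨hb.1, hb.2.trans_le hle'⟩
    omega

/-- The union of the order-reversing matchings of `A σ τ` and `B σ τ` over the four quadrants. -/
def quadrantMatching (A B : Bool → Bool → Finset ℕ) : Finset (Bool × Bool × ℕ × ℕ) :=
  (Finset.univ : Finset (Bool × Bool)).biUnion fun c =>
    (antitoneMatching (A c.1 c.2) (B c.1 c.2)).image fun p => (c.1, c.2, p)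

theorem mem_quadrantMatching {A B : Bool → Bool → Finset ℕ} {σ τ : Bool} {i j : ℕ} :
    (σ, τ, i, j) ∈ quadrantMatching A B ↔ (i, j) ∈ antitoneMatching (A σ τ) (B σ τ) := by
  simp only [quadrantMatching, Finset.mem_biUnion, Finset.mem_univ, true_and, Finset.mem_image]
  constructor
  · rintro ⟨c, p, hp, e⟩
    simp only [Prod.mk.injEq] at e
    obtain ⟨rfl, rfl, rfl⟩ := e
    exact hp
  · intro h
    exact ⟨(σ, τ), (i, j), h, rfl⟩

theorem quadrantMatching_subset {A B A' B' : Bool → Bool → Finset ℕ}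
    (hc : ∀ σ τ, (A σ τ).card = (B σ τ).card)
    (h : quadrantMatching A B = quadrantMatching A' B') (σ τ : Bool) :
    A σ τ ⊆ A' σ τ ∧ B σ τ ⊆ B' σ τ := by
  have key : ∀ {i j}, (i, j) ∈ antitoneMatching (A σ τ) (B σ τ) → i ∈ A' σ τ ∧ j ∈ B' σ τ :=
    fun hij => (mem_antitoneMatching.1 (mem_quadrantMatching.1
      (h ▸ mem_quadrantMatching.2 hij))).1
  refine ⟨fun i hi => ?_, fun j hj => ?_⟩
  · obtain ⟨j, hij⟩ := exists_mem_antitoneMatching_left (hc σ τ) hi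
    exact (key hij).1
  · obtain ⟨i, hij⟩ := exists_mem_antitoneMatching_right (hc σ τ) hj
    exact (key hij).2

theorem quadrantMatching_inj {A B A' B' : Bool → Bool → Finset ℕ}
    (hc : ∀ σ τ, (A σ τ).card = (B σ τ).card) (hc' : ∀ σ τ, (A' σ τ).card = (B' σ τ).card)
    (h : quadrantMatching A B = quadrantMatching A' B') : A = A' ∧ B = B' := by
  constructor <;> funext σ τ
  · exact (quadrantMatching_subset hc h σ τ).1.antisymm
      (quadrantMatching_subset hc' h.symm σ τ).1
  · exact (quadrantMatching_subset hc h σ τ).2.antisymm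
      (quadrantMatching_subset hc' h.symm σ τ).2

theorem sgn_mul_sgn_mul_self (b : Bool) (x : ℝ) : sgn b * (sgn b * x) = x := by
  cases b <;> simp [sgn]

theorem sgn_mul_sgn_mul_of_ne {b c : Bool} (h : b ≠ c) (x : ℝ) : sgn b * (sgn c * x) = -x := by
  cases b <;> cases c <;> simp_all [sgn]

/-- The weight K^(i+1) turns the distance of column i from ±1 into exactly 1, the spacing of the
rows. The value at t is then K^(i+1) + j. -/
theorem quadrantMatching_strict_functional {A B : Bool → Bool → Finset ℕ} {N : ℕ} {K : ℝ}
    (hB : ∀ σ τ, ∀ j ∈ B σ τ, j < N) (hK : N + 1 < K) {t : Bool × Bool × ℕ × ℕ}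
    (ht : t ∈ quadrantMatching A B) :
    ∃ a b : ℝ, ∀ u ∈ quadrantMatching A B, u ≠ t →
      a * (gridPoint K u).1 + b * (gridPoint K u).2 <
        a * (gridPoint K t).1 + b * (gridPoint K t).2 := by
  obtain ⟨σ, τ, i, j⟩ := t
  refine ⟨K ^ (i + 1) * sgn σ, sgn τ, ?_⟩
  rintro ⟨σ', τ', i', j'⟩ hu hne
  have hN : (0 : ℝ) ≤ N := Nat.cast_nonneg N
  have hK1 : 1 < K := by linarith
  have hK0 : 0 < K := by linarith
  have hpos : ∀ k : ℕ, 0 < K ^ k := fun k => pow_pos hK0 k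
  have hmt := mem_quadrantMatching.1 ht
  have hmu := mem_quadrantMatching.1 hu
  have hj' : (j' : ℝ) + 1 ≤ N := by
    exact_mod_cast hB σ' τ' j' (mem_antitoneMatching.1 hmu).1.2
  have hj0 : (0 : ℝ) ≤ j := Nat.cast_nonneg j
  have hj'0 : (0 : ℝ) ≤ j' := Nat.cast_nonneg j'
  have hy : sgn τ * ordinate τ' j' ≤ j' + 1 := by
    unfold ordinate
    by_cases e : τ = τ'
    · rw [← e, sgn_mul_sgn_mul_self]
    · rw [sgn_mul_sgn_mul_of_ne e]; linarith
  simp only [gridPoint, mul_assoc]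
  have hrhs : K ^ (i + 1) * (sgn σ * abscissa K σ i) + sgn τ * ordinate τ j = K ^ (i + 1) + j := by
    unfold abscissa ordinate
    rw [sgn_mul_sgn_mul_self, sgn_mul_sgn_mul_self, mul_sub, mul_inv_cancel₀ (hpos _).ne']
    ring
  rw [hrhs]
  by_cases hσ : σ = σ'
  · subst hσ
    unfold abscissa
    rw [sgn_mul_sgn_mul_self]
    rcases lt_or_ge i' i with hi | hi
    · have h1 : K ≤ K ^ (i + 1) * (K ^ (i' + 1))⁻¹ := by
        rw [← div_eq_mul_inv, le_div_iff₀ (hpos _), ← pow_succ']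
        exact pow_le_pow_right₀ hK1.le (by omega)
      rw [mul_sub]
      linarith
    · have h1 : 0 < K ^ (i + 1) * (K ^ (i' + 1))⁻¹ := mul_pos (hpos _) (inv_pos.2 (hpos _))
      rw [mul_sub, mul_one]
      have h2 : sgn τ * ordinate τ' j' ≤ j := by
        unfold ordinate
        by_cases e : τ = τ'
        · subst e
          rw [sgn_mul_sgn_mul_self]
          have := antitoneMatching_snd_lt hmt hmu hi fun e => hne (by simp_all)
          exact_mod_cast this
        · rw [sgn_mul_sgn_mul_of_ne e]; linarith
      linarith
  · have h1 : K ≤ K ^ (i + 1) := by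
      simpa using pow_le_pow_right₀ hK1.le (show 1 ≤ i + 1 by omega)
    have h2 : sgn σ * abscissa K σ' i' ≤ 0 := by
      unfold abscissa
      rw [sgn_mul_sgn_mul_of_ne hσ]
      have : (K ^ (i' + 1))⁻¹ ≤ 1 := inv_le_one_of_one_le₀ (one_le_pow₀ hK1.le)
      linarith
    have h3 : K ^ (i + 1) * (sgn σ * abscissa K σ' i') ≤ 0 :=
      mul_nonpos_of_nonneg_of_nonpos (hpos _).le h2
    linarith

/-- The vertex set given by matchings in the four quadrants. -/
noncomputable def matchingPoints (K : ℝ) (A B : Bool → Bool → Finset ℕ) : Finset (ℝ × ℝ) :=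
  (quadrantMatching A B).image (gridPoint K)

theorem vertices_matchingPoints {A B : Bool → Bool → Finset ℕ} {N : ℕ} {K : ℝ}
    (hB : ∀ σ τ, ∀ j ∈ B σ τ, j < N) (hK : N + 1 < K) :
    vertices (convexHull ℝ (matchingPoints K A B : Set (ℝ × ℝ))) = matchingPoints K A B := by
  refine vertices_convexHull_eq fun p hp => ?_
  obtain ⟨t, ht, rfl⟩ := Finset.mem_image.1 hp
  obtain ⟨a, b, h⟩ := quadrantMatching_strict_functional hB hK ht
  refine ⟨a, b, fun q hq hne => ?_⟩
  obtain ⟨u, hu, rfl⟩ := Finset.mem_image.1 hq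
  exact h u hu fun e => hne (by rw [e])

/-! ### Distributing lines over quadrants -/

/-- The indices of the grid lines of one direction: `m` on the negative side, `m + r` on the
positive side. -/
def lineIndices (m r : ℕ) : Finset (Bool × ℕ) :=
  (Finset.range m).image (Prod.mk false) ∪ (Finset.range (m + r)).image (Prod.mk true)

theorem mem_lineIndices {m r : ℕ} {σ : Bool} {i : ℕ} :
    (σ, i) ∈ lineIndices m r ↔ i < m ∨ σ = true ∧ i < m + r := by
  cases σ <;> simp [lineIndices]
  omega

theorem card_lineIndices (m r : ℕ) : (lineIndices m r).card = 2 * m + r := by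
  rw [lineIndices, Finset.card_union_of_disjoint, Finset.card_image_of_injective _
    (Prod.mk_right_injective _), Finset.card_image_of_injective _ (Prod.mk_right_injective _)]
  · simp only [Finset.card_range]; ring
  · rw [Finset.disjoint_left]
    intro p hp hq
    obtain ⟨_, -, rfl⟩ := Finset.mem_image.1 hp
    obtain ⟨_, -, h⟩ := Finset.mem_image.1 hq
    simp at h

/-- The abscissae of the grid lines of `lineIndices m r`. -/
noncomputable def gridAbscissae (K : ℝ) (m r : ℕ) : Finset ℝ :=
  (lineIndices m r).image fun l => abscissa K l.1 l.2

/-- The ordinates of the grid lines of `lineIndices m r`. -/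
noncomputable def gridOrdinates (m r : ℕ) : Finset ℝ :=
  (lineIndices m r).image fun l => ordinate l.1 l.2

theorem card_gridAbscissae {K : ℝ} (hK : 1 < K) (m r : ℕ) :
    (gridAbscissae K m r).card = 2 * m + r := by
  rw [gridAbscissae, Finset.card_image_of_injective, card_lineIndices]
  rintro ⟨σ, i⟩ ⟨σ', i'⟩ h
  obtain ⟨rfl, rfl⟩ := abscissa_injective hK h
  rfl

theorem card_gridOrdinates (m r : ℕ) : (gridOrdinates m r).card = 2 * m + r := by
  rw [gridOrdinates, Finset.card_image_of_injective, card_lineIndices]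
  rintro ⟨σ, i⟩ ⟨σ', i'⟩ h
  obtain ⟨rfl, rfl⟩ := ordinate_injective h
  rfl

/-- The extra lines, all used in the positive quadrant. -/
def extraLines (m r : ℕ) (σ τ : Bool) : Finset ℕ :=
  if σ && τ then Finset.Ico m (m + r) else ∅

/-- The two sets of a pair, the first used in the quadrants with `σ = τ`. -/
def selectLines (p : Finset ℕ × Finset ℕ) (σ τ : Bool) : Finset ℕ :=
  if σ = τ then p.1 else p.2

/-- The columns used in each quadrant. -/
def columns (m r : ℕ) (w : Bool → Finset ℕ × Finset ℕ) (σ τ : Bool) : Finset ℕ :=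
  selectLines (w σ) σ τ ∪ extraLines m r σ τ

/-- The pairs of `labelPairs` with prescribed sizes. -/
def sizedPairs (cover disj : Bool) (m : ℕ) (ab : ℕ × ℕ) : Finset (Finset ℕ × Finset ℕ) :=
  (labelPairs cover disj (Finset.range m)).filter fun p => (p.1.card, p.2.card) = ab

theorem mem_sizedPairs {cover disj : Bool} {m : ℕ} {ab : ℕ × ℕ} {p : Finset ℕ × Finset ℕ} :
    p ∈ sizedPairs cover disj m ab ↔
      p ∈ labelPairs cover disj (Finset.range m) ∧ (p.1.card, p.2.card) = ab := by
  simp [sizedPairs]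

theorem selectLines_subset {cover disj : Bool} {m : ℕ} {ab : ℕ × ℕ} {p : Finset ℕ × Finset ℕ}
    (hp : p ∈ sizedPairs cover disj m ab) (σ τ : Bool) : selectLines p σ τ ⊆ Finset.range m := by
  obtain ⟨h1, h2⟩ := (mem_labelPairs.1 (mem_sizedPairs.1 hp).1).1
  unfold selectLines
  split_ifs <;> assumption

theorem disjoint_range_extraLines (m r : ℕ) (σ τ : Bool) :
    Disjoint (Finset.range m) (extraLines m r σ τ) := by
  unfold extraLines
  split_ifs
  · rw [Finset.disjoint_left]
    intro i hi hi'
    simp at hi hi'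
    omega
  · simp

section columns

variable {cover disj : Bool} {m : ℕ} {ab : ℕ × ℕ} {w : Bool → Finset ℕ × Finset ℕ}

theorem card_columns (hw : ∀ σ, w σ ∈ sizedPairs cover disj m ab) (r : ℕ) (σ τ : Bool) :
    (columns m r w σ τ).card = (if σ = τ then ab.1 else ab.2) + (extraLines m r σ τ).card := by
  rw [columns, Finset.card_union_of_disjoint
    ((disjoint_range_extraLines m r σ τ).mono_left (selectLines_subset (hw σ) σ τ))]
  have := (mem_sizedPairs.1 (hw σ)).2
  rw [← this]
  unfold selectLines
  split_ifs <;> rfl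

/-- Extra lines have index at least m, so cutting back to indices below m recovers the chosen pair.
-/
theorem columns_inter_range (hw : ∀ σ, w σ ∈ sizedPairs cover disj m ab) (r : ℕ) (σ τ : Bool) :
    columns m r w σ τ ∩ Finset.range m = selectLines (w σ) σ τ := by
  rw [columns, Finset.union_inter_distrib_right,
    Finset.inter_eq_left.2 (selectLines_subset (hw σ) σ τ),
    Finset.disjoint_iff_inter_eq_empty.1 (disjoint_range_extraLines m r σ τ).symm,
    Finset.union_empty]

theorem columns_injective {w' : Bool → Finset ℕ × Finset ℕ} {r : ℕ}
    (hw : ∀ σ, w σ ∈ sizedPairs cover disj m ab) (hw' : ∀ σ, w' σ ∈ sizedPairs cover disj m ab)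
    (h : columns m r w = columns m r w') : w = w' := by
  funext σ
  have key : ∀ τ, selectLines (w σ) σ τ = selectLines (w' σ) σ τ := fun τ => by
    rw [← columns_inter_range hw r, ← columns_inter_range hw' r, h]
  refine Prod.ext ?_ ?_
  · simpa [selectLines] using key σ
  · simpa [selectLines] using key (!σ)

theorem mem_lineIndices_of_mem_columns (hw : ∀ σ, w σ ∈ sizedPairs cover disj m ab) {r : ℕ}
    {σ τ : Bool} {i : ℕ} (hi : i ∈ columns m r w σ τ) : (σ, i) ∈ lineIndices m r := by
  rw [mem_lineIndices]
  rcases Finset.mem_union.1 hi with h | h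
  · exact Or.inl (Finset.mem_range.1 (selectLines_subset (hw σ) σ τ h))
  · unfold extraLines at h
    split_ifs at h with hc
    · simp only [Bool.and_eq_true] at hc
      exact Or.inr ⟨hc.1, (Finset.mem_Ico.1 h).2⟩
    · simp at h

theorem exists_mem_columns (hw : ∀ σ, w σ ∈ sizedPairs cover disj m ab) (hc : cover) {r : ℕ}
    {σ : Bool} {i : ℕ} (hi : (σ, i) ∈ lineIndices m r) : ∃ τ, i ∈ columns m r w σ τ := by
  rw [mem_lineIndices] at hi
  by_cases him : i < m
  · have h1 := (mem_labelPairs.1 (mem_sizedPairs.1 (hw σ)).1).2.1 hc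
    have : i ∈ (w σ).1 ∪ (w σ).2 := h1 ▸ Finset.mem_range.2 him
    rcases Finset.mem_union.1 this with h | h
    · exact ⟨σ, Finset.mem_union_left _ (by simpa [selectLines] using h)⟩
    · exact ⟨!σ, Finset.mem_union_left _ (by simpa [selectLines] using h)⟩
  · obtain ⟨rfl, hir⟩ := hi.resolve_left him
    exact ⟨true, Finset.mem_union_right _ (by simp [extraLines, hir, not_lt.1 him])⟩

theorem eq_of_mem_columns (hw : ∀ σ, w σ ∈ sizedPairs cover disj m ab) (hd : disj) {r : ℕ}
    {σ τ τ' : Bool} {i : ℕ} (h : i ∈ columns m r w σ τ) (h' : i ∈ columns m r w σ τ') :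
    τ = τ' := by
  have hdisj := Finset.disjoint_left.1 ((mem_labelPairs.1 (mem_sizedPairs.1 (hw σ)).1).2.2 hd)
  by_cases him : i < m
  · have key : ∀ τ, i ∈ columns m r w σ τ → i ∈ selectLines (w σ) σ τ := fun τ h => by
      rw [← columns_inter_range hw r]
      exact Finset.mem_inter.2 ⟨h, Finset.mem_range.2 him⟩
    have h1 := key τ h
    have h2 := key τ' h'
    unfold selectLines at h1 h2
    split_ifs at h1 h2 with e1 e2 e2
    · exact e1.symm.trans e2
    · exact absurd h2 (hdisj h1)
    · exact absurd h1 (hdisj h2)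
    · revert e1 e2; cases σ <;> cases τ <;> cases τ' <;> simp
  · have key : ∀ τ, i ∈ columns m r w σ τ → τ = true := fun τ h => by
      rcases Finset.mem_union.1 h with h | h
      · exact absurd (Finset.mem_range.1 (selectLines_subset (hw σ) σ τ h)) him
      · unfold extraLines at h
        split_ifs at h with hc
        · simp only [Bool.and_eq_true] at hc
          exact hc.2
        · simp at h
    rw [key τ h, key τ' h']

end columns

/-! ### The polygons of the lower bound -/

/-- The polygon given by a choice of columns and rows. -/
noncomputable def latticePolygon (K : ℝ) (m r : ℕ) (w : Bool × Bool → Finset ℕ × Finset ℕ) :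
    Set (ℝ × ℝ) :=
  convexHull ℝ (matchingPoints K (columns m r fun σ => w (false, σ))
    (fun σ τ => columns m r (fun τ => w (true, τ)) τ σ) : Set (ℝ × ℝ))

section latticePolygon

variable {cover disj : Bool} {m r : ℕ} {ab : ℕ × ℕ} {w : Bool × Bool → Finset ℕ × Finset ℕ}
  {K : ℝ}

/-- The size depends only on whether σ = τ and on whether both are positive. These conditions are
symmetric in σ and τ, and all four half-axes share the sizes `ab`. -/
theorem card_columns_eq_card_rows (hw : ∀ c, w c ∈ sizedPairs cover disj m ab) (σ τ : Bool) :
    (columns m r (fun σ => w (false, σ)) σ τ).card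
      = (columns m r (fun τ => w (true, τ)) τ σ).card := by
  rw [card_columns (fun σ => hw _), card_columns (fun τ => hw _)]
  cases σ <;> cases τ <;> rfl

theorem vertices_latticePolygon (hw : ∀ c, w c ∈ sizedPairs cover disj m ab)
    (hK : ((m + r : ℕ) : ℝ) + 1 < K) :
    vertices (latticePolygon K m r w) = matchingPoints K (columns m r fun σ => w (false, σ))
      (fun σ τ => columns m r (fun τ => w (true, τ)) τ σ) := by
  refine vertices_matchingPoints (N := m + r) (fun σ τ j hj => ?_) hK
  have := mem_lineIndices.1 (mem_lineIndices_of_mem_columns (fun τ => hw (true, τ)) hj)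
  omega

/-- The vertices determine the matched index pairs, which determine the columns and rows of each
quadrant, and these determine the chosen pairs. -/
theorem latticePolygon_injective {w' : Bool × Bool → Finset ℕ × Finset ℕ}
    (hw : ∀ c, w c ∈ sizedPairs cover disj m ab) (hw' : ∀ c, w' c ∈ sizedPairs cover disj m ab)
    (hK : ((m + r : ℕ) : ℝ) + 1 < K) (h : latticePolygon K m r w = latticePolygon K m r w') :
    w = w' := by
  have hK1 : 1 < K := by
    have : (0 : ℝ) ≤ ((m + r : ℕ) : ℝ) := Nat.cast_nonneg _
    linarith
  have e := congrArg vertices h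
  rw [vertices_latticePolygon hw hK, vertices_latticePolygon hw' hK, Finset.coe_inj] at e
  obtain ⟨h1, h2⟩ := quadrantMatching_inj (card_columns_eq_card_rows hw)
    (card_columns_eq_card_rows hw') (Finset.image_injective (gridPoint_injective hK1) e)
  have h3 := columns_injective (fun σ => hw _) (fun σ => hw' _) h1
  have h4 := columns_injective (r := r) (w := fun τ => w (true, τ)) (w' := fun τ => w' (true, τ))
    (fun σ => hw _) (fun σ => hw' _)
    (funext fun τ => funext fun σ => congrFun (congrFun h2 σ) τ)
  funext ⟨b, σ⟩
  cases b
  · exact congrFun h3 σ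
  · exact congrFun h4 σ

/-- Each of the r extra columns carries a vertex. With 3 ≤ r the hull is therefore nondegenerate
even if all chosen sets are empty. -/
theorem le_card_matchingPoints (hw : ∀ c, w c ∈ sizedPairs cover disj m ab) (hK : 1 < K) :
    r ≤ (matchingPoints K (columns m r fun σ => w (false, σ))
      (fun σ τ => columns m r (fun τ => w (true, τ)) τ σ)).card := by
  rw [matchingPoints, Finset.card_image_of_injective _ (gridPoint_injective hK)]
  have hr : (Finset.Ico m (m + r)).card = r := by simp
  refine hr.symm.trans_le ?_
  refine Finset.card_le_card_of_surjOn (fun t => t.2.2.1) fun i hi => ?_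
  have hi' : i ∈ columns m r (fun σ => w (false, σ)) true true :=
    Finset.mem_union_right _ (by simpa [extraLines] using hi)
  obtain ⟨j, hj⟩ := exists_mem_antitoneMatching_left
    (card_columns_eq_card_rows (r := r) hw true true) hi'
  exact ⟨(true, true, i, j), mem_quadrantMatching.2 hj, rfl⟩

theorem latticePolygon_mem (hw : ∀ c, w c ∈ sizedPairs cover disj m ab)
    (hK : ((m + r : ℕ) : ℝ) + 1 < K) (hr : 3 ≤ r) :
    latticePolygon K m r w ∈ polygonsOfKind cover disj (gridAbscissae K m r)
      (gridOrdinates m r) := by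
  have hK1 : 1 < K := by
    have : (0 : ℝ) ≤ ((m + r : ℕ) : ℝ) := Nat.cast_nonneg _
    linarith
  have hv := vertices_latticePolygon hw hK
  have hcard := card_columns_eq_card_rows (r := r) hw
  have hmem : ∀ v, v ∈ vertices (latticePolygon K m r w) ↔ ∃ σ τ i j,
      (i, j) ∈ antitoneMatching (columns m r (fun σ => w (false, σ)) σ τ)
        (columns m r (fun τ => w (true, τ)) τ σ) ∧
      (abscissa K σ i, ordinate τ j) = v := by
    intro v
    rw [hv, Finset.mem_coe, matchingPoints, Finset.mem_image]
    constructor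
    · rintro ⟨⟨σ, τ, i, j⟩, h, rfl⟩
      exact ⟨σ, τ, i, j, mem_quadrantMatching.1 h, rfl⟩
    · rintro ⟨σ, τ, i, j, h, rfl⟩
      exact ⟨(σ, τ, i, j), mem_quadrantMatching.2 h, rfl⟩
  refine ⟨isConvexPolygon_convexHull hv (hr.trans (le_card_matchingPoints hw hK1)),
    fun v hv' => ?_, fun hc => ⟨fun x hx => ?_, fun y hy => ?_⟩, fun hd u hu v hv huv => ?_⟩
  · obtain ⟨σ, τ, i, j, h, rfl⟩ := (hmem v).1 hv'
    obtain ⟨hi, hj⟩ := (mem_antitoneMatching.1 h).1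
    exact ⟨Finset.mem_image.2
        ⟨(σ, i), mem_lineIndices_of_mem_columns (fun σ => hw (false, σ)) hi, rfl⟩,
      Finset.mem_image.2
        ⟨(τ, j), mem_lineIndices_of_mem_columns (fun τ => hw (true, τ)) hj, rfl⟩⟩
  · obtain ⟨⟨σ, i⟩, hi, rfl⟩ := Finset.mem_image.1 hx
    obtain ⟨τ, h⟩ := exists_mem_columns (fun σ => hw (false, σ)) hc hi
    obtain ⟨j, hj⟩ := exists_mem_antitoneMatching_left (hcard σ τ) h
    exact ⟨_, (hmem _).2 ⟨σ, τ, i, j, hj, rfl⟩, rfl⟩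
  · obtain ⟨⟨τ, j⟩, hj, rfl⟩ := Finset.mem_image.1 hy
    obtain ⟨σ, h⟩ := exists_mem_columns (fun τ => hw (true, τ)) hc hj
    obtain ⟨i, hi⟩ := exists_mem_antitoneMatching_right (hcard σ τ) h
    exact ⟨_, (hmem _).2 ⟨σ, τ, i, j, hi, rfl⟩, rfl⟩
  · obtain ⟨σ, τ, i, j, h, rfl⟩ := (hmem u).1 hu
    obtain ⟨σ', τ', i', j', h', rfl⟩ := (hmem v).1 hv
    obtain ⟨hi, hj⟩ := (mem_antitoneMatching.1 h).1
    obtain ⟨hi', hj'⟩ := (mem_antitoneMatching.1 h').1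
    rcases huv with e | e
    · obtain ⟨rfl, rfl⟩ := abscissa_injective hK1 e
      obtain rfl := eq_of_mem_columns (fun σ => hw (false, σ)) hd hi hi'
      by_contra hne
      exact lt_asymm (antitoneMatching_snd_lt h h' le_rfl fun e => hne (by simp_all))
        (antitoneMatching_snd_lt h' h le_rfl fun e => hne (by simp_all))
    · obtain ⟨rfl, rfl⟩ := ordinate_injective e
      obtain rfl := eq_of_mem_columns (fun τ => hw (true, τ)) hd hj hj'
      by_contra hne
      have hne' : (i, j) ≠ (i', j) := fun e => hne (by simp_all)
      rcases le_total i i' with hle | hle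
      · exact lt_irrefl _ (antitoneMatching_snd_lt h h' hle hne')
      · exact lt_irrefl _ (antitoneMatching_snd_lt h' h hle hne'.symm)

end latticePolygon

/-! ### Asymptotics -/

theorem polygonsOfKind_subset (cover disj : Bool) (X Y : Finset ℝ) :
    polygonsOfKind cover disj X Y ⊆ containedPolygons X Y :=
  fun _ h => ⟨h.1, h.2.1⟩

/-- The exponent 4 counts the half-axes, whose pairs are chosen independently. -/
theorem card_sizedPairs_pow_le (cover disj : Bool) (m : ℕ) (ab : ℕ × ℕ) {r : ℕ} (hr : 3 ≤ r) :
    (sizedPairs cover disj m ab).card ^ 4 ≤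
      maxCount (polygonsOfKind cover disj) (2 * m + r) := by
  set K : ℝ := ((m + r : ℕ) : ℝ) + 2
  have hK : ((m + r : ℕ) : ℝ) + 1 < K := by simp [K]
  have hK1 : 1 < K := by
    have : (0 : ℝ) ≤ ((m + r : ℕ) : ℝ) := Nat.cast_nonneg _
    linarith
  refine le_trans ?_ ((isGreatest_maxCount (polygonsOfKind_subset cover disj) _).2
    ⟨gridAbscissae K m r, gridOrdinates m r, card_gridAbscissae hK1 m r,
      card_gridOrdinates m r, rfl⟩)
  have hc : (Fintype.piFinset fun _ : Bool × Bool => sizedPairs cover disj m ab).card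
      = (sizedPairs cover disj m ab).card ^ 4 := by
    simp [Fintype.card_piFinset]
  rw [← hc, ← Set.ncard_coe_finset]
  refine Set.ncard_le_ncard_of_injOn (latticePolygon K m r) (fun w hw => ?_)
    (fun w hw w' hw' h => ?_)
    ((containedPolygons_finite_and_ncard_le _ _).1.subset (polygonsOfKind_subset cover disj _ _))
  · exact latticePolygon_mem (Fintype.mem_piFinset.1 hw) hK hr
  · exact latticePolygon_injective (Fintype.mem_piFinset.1 hw) (Fintype.mem_piFinset.1 hw') hK h

/-- Pigeonhole over the (m + 1)² possible pairs of sizes. -/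
theorem exists_le_card_sizedPairs (cover disj : Bool) (m : ℕ) :
    ∃ ab, (labels cover disj).card ^ m ≤ (m + 1) ^ 2 * (sizedPairs cover disj m ab).card := by
  by_contra! h
  have hsum := Finset.card_eq_sum_card_fiberwise (s := labelPairs cover disj (Finset.range m))
    (f := fun p => (p.1.card, p.2.card)) (t := Finset.range (m + 1) ×ˢ Finset.range (m + 1)) (by
      intro p hp
      obtain ⟨⟨h1, h2⟩, -⟩ := mem_labelPairs.1 hp
      have h1 := Finset.card_le_card h1
      have h2 := Finset.card_le_card h2
      rw [Finset.card_range] at h1 h2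
      simp only [Finset.coe_product, Set.mem_prod, Finset.mem_coe, Finset.mem_range]
      omega)
  rw [card_labelPairs, Finset.card_range] at hsum
  have hlt : (m + 1) ^ 2 * (labels cover disj).card ^ m
      < (m + 1) ^ 2 * (labels cover disj).card ^ m := by
    calc (m + 1) ^ 2 * (labels cover disj).card ^ m
        = ∑ ab ∈ Finset.range (m + 1) ×ˢ Finset.range (m + 1),
            (m + 1) ^ 2 * (sizedPairs cover disj m ab).card := by
          rw [← Finset.mul_sum, hsum]; rfl
      _ < ∑ _ab ∈ Finset.range (m + 1) ×ˢ Finset.range (m + 1),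
            (labels cover disj).card ^ m :=
          Finset.sum_lt_sum_of_nonempty ⟨(0, 0), by simp⟩ fun ab _ => h ab
      _ = (m + 1) ^ 2 * (labels cover disj).card ^ m := by
          simp [sq]
  exact lt_irrefl _ hlt

theorem card_labels_pow_le (cover disj : Bool) (m : ℕ) {r : ℕ} (hr : 3 ≤ r) :
    ((labels cover disj).card ^ 2) ^ (2 * m) ≤
      (m + 1) ^ 8 * maxCount (polygonsOfKind cover disj) (2 * m + r) := by
  obtain ⟨ab, h⟩ := exists_le_card_sizedPairs cover disj m
  calc ((labels cover disj).card ^ 2) ^ (2 * m) = ((labels cover disj).card ^ m) ^ 4 := by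
        rw [← pow_mul, ← pow_mul]; congr 1; ring
    _ ≤ ((m + 1) ^ 2 * (sizedPairs cover disj m ab).card) ^ 4 := Nat.pow_le_pow_left h 4
    _ = (m + 1) ^ 8 * (sizedPairs cover disj m ab).card ^ 4 := by ring
    _ ≤ _ := Nat.mul_le_mul_left _ (card_sizedPairs_pow_le cover disj m ab hr)

theorem maxCount_polygonsOfKind_le (cover disj : Bool) (n : ℕ) :
    maxCount (polygonsOfKind cover disj) n ≤
      (n + 1) ^ 4 * ((labels cover disj).card ^ 2) ^ n := by
  obtain ⟨X, Y, hX, hY, h⟩ := (isGreatest_maxCount (polygonsOfKind_subset cover disj) n).1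
  have := ncard_polygonsOfKind_le cover disj X Y
  rw [← h, hX, hY] at this
  refine this.trans_eq ?_
  rw [← pow_mul, mul_comm 2 n, pow_mul]
  ring

theorem labels_card_pos (cover disj : Bool) : 0 < (labels cover disj).card := by
  revert cover disj; decide

theorem isThetaStar_maxCount (cover disj : Bool) :
    IsThetaStar (fun n => (maxCount (polygonsOfKind cover disj) n : ℝ))
      (fun n => (((labels cover disj).card ^ 2 : ℕ) : ℝ) ^ n) := by
  set c := (labels cover disj).card ^ 2 with hc
  have hc1 : 1 ≤ c := Nat.one_le_pow _ _ (labels_card_pos cover disj)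
  constructor
  · refine ⟨4, IsBigO.of_bound (2 ^ 4) ?_⟩
    filter_upwards [eventually_ge_atTop 1] with n hn
    rw [Real.norm_of_nonneg (by positivity), Real.norm_of_nonneg (by positivity)]
    have h := maxCount_polygonsOfKind_le cover disj n
    have h2 : (n + 1) ^ 4 * c ^ n ≤ 2 ^ 4 * (n ^ 4 * c ^ n) := by
      rw [← mul_assoc, ← mul_pow]
      exact Nat.mul_le_mul_right _ (Nat.pow_le_pow_left (by omega) 4)
    exact_mod_cast h.trans h2
  -- The exponent 8 is the fourth power of the pigeonhole loss (m + 1)². The constant c^4 pays for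
  -- the at most four extra lines in each direction.
  · refine ⟨8, IsBigO.of_bound ((c ^ 4 : ℕ) : ℝ) ?_⟩
    filter_upwards [eventually_ge_atTop 3] with n hn
    rw [Real.norm_of_nonneg (by positivity), Real.norm_of_nonneg (by positivity)]
    -- r is 3 or 4, according to the parity of n.
    obtain ⟨m, r, hr, hr', rfl⟩ : ∃ m r, 3 ≤ r ∧ r ≤ 4 ∧ n = 2 * m + r :=
      ⟨(n - 3) / 2, 3 + (n - 3) % 2, by omega, by omega, by omega⟩
    have h := card_labels_pow_le cover disj m hr
    have h2 : c ^ (2 * m + r) ≤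
        c ^ 4 * ((2 * m + r) ^ 8 * maxCount (polygonsOfKind cover disj) (2 * m + r)) := by
      rw [pow_add, mul_comm (c ^ (2 * m))]
      refine Nat.mul_le_mul (Nat.pow_le_pow_right hc1 hr') (h.trans ?_)
      exact Nat.mul_le_mul_right _ (Nat.pow_le_pow_left (by omega) 8)
    exact_mod_cast h2

end ConvexGrid

theorem theorem1 :
    ConvexGrid.IsThetaStar (fun n : ℕ => (ConvexGrid.F n : ℝ)) (fun n : ℕ => (16 : ℝ) ^ n) ∧
    ConvexGrid.IsThetaStar (fun n : ℕ => (ConvexGrid.Fbar n : ℝ)) (fun n : ℕ => (9 : ℝ) ^ n) ∧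
    ConvexGrid.IsThetaStar (fun n : ℕ => (ConvexGrid.G n : ℝ)) (fun n : ℕ => (9 : ℝ) ^ n) ∧
    ConvexGrid.IsThetaStar (fun n : ℕ => (ConvexGrid.Gbar n : ℝ)) (fun n : ℕ => (4 : ℝ) ^ n) := by
  -- The pattern count is squared because the vertical and the horizontal lines each contribute one
  -- factor per line.
  have key : ∀ (cover disj : Bool) (kind : Finset ℝ → Finset ℝ → Set (Set (ℝ × ℝ))) (c : ℕ),
      ConvexGrid.polygonsOfKind cover disj = kind →
      (ConvexGrid.labels cover disj).card ^ 2 = c →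
      ConvexGrid.IsThetaStar (fun n : ℕ => (ConvexGrid.maxCount kind n : ℝ))
        (fun n : ℕ => (c : ℝ) ^ n) := by
    rintro cover disj _ _ rfl rfl
    exact ConvexGrid.isThetaStar_maxCount cover disj
  refine ⟨?_, ?_, ?_, ?_⟩
  · refine key false false ConvexGrid.containedPolygons 16 ?_ (by decide)
    funext X Y
    simp [ConvexGrid.polygonsOfKind, ConvexGrid.containedPolygons]
  · refine key false true ConvexGrid.supportedPolygons 9 ?_ (by decide)
    funext X Y
    simp [ConvexGrid.polygonsOfKind, ConvexGrid.supportedPolygons]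
  · refine key true false ConvexGrid.allLinesPolygons 9 ?_ (by decide)
    funext X Y
    simp [ConvexGrid.polygonsOfKind, ConvexGrid.allLinesPolygons]
  · refine key true true ConvexGrid.exactlyOncePolygons 4 ?_ (by decide)
    funext X Y
    simp [ConvexGrid.polygonsOfKind, ConvexGrid.exactlyOncePolygons]
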